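/- Let $d,n\ge 1$ and work with operators on $(\mathbb C^d)^{\otimes n}$. For $\alpha\in\mathbb N^d$ with $|\alpha|=\alpha_1+\dots+\alpha_d=n$, the Dicke state is $$|D_\alpha\rangle=\binom{n}{\alpha}^{-1/2}\sum_{i}|i_1\cdots i_n\rangle ,\qquad \binom{n}{\alpha}=\frac{n!}{\alpha_1!\cdots\alpha_d!},$$ where the sum is over all $i\in\{1,\dots,d\}^n$ in which every value $j$ occurs exactly $\alpha_j$ times. A mixture of Dicke states is an operator $\rho=\sum_{|\alpha|=n}p_\alpha|D_\alpha\rangle\langle D_\alpha|$ with $p_\alpha\ge 0$ and $\sum_\alpha p_\alpha=1$. An operator $X$ is diagonally symmetric if $\Pi X\Pi=X$, where $\Pi=\frac1{n!}\sum_{\pi\in S_n}P_\pi$ is the projection onto the symmetric subspace ($P_\pi$ permutes the tensor factors), and $X$ commutes with $U^{\otimes n}$ for every diagonal unitary $d\times d$ matrix $U$. An operator is PPT across all bipartitions if for every $I\subseteq\{1,\dots,n\}$ its partial transpose $X^{\Gamma_I}$ on the tensor factors in $I$ is positive semidefinite. It is separable if it is a finite sum of operators $|\psi\rangle\langle\psi|$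 with $\psi=v_1\otimes\dots\otimes v_n$, $v_k\in\mathbb C^d$, and entangled if it is not separable. Theorem. For every $d\ge 3$ and every $n\ge 3$ there exists a quantum state (a positive semidefinite operator of trace one) on $(\mathbb C^d)^{\otimes n}$ that is diagonally symmetric, is a mixture of Dicke states, is PPT across all bipartitions, and is entangled. In particular, for $d=3$ and likewise for $d=4$, it is not true that for every $n$ every mixture of Dicke states on $(\mathbb C^d)^{\otimes n}$ that is PPT across all bipartitions is separable. -/

import Mathlib

open scoped ComplexOrder

noncomputable section

namespace DickePPT

/-- Operators on `(ℂ^d)^{⊗n}`, written in the computational basis `|i₁ … i_n⟩`,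
which is indexed by the multi-indices `i : Fin n → Fin d`. -/
abbrev Operator (n d : ℕ) : Type := Matrix (Fin n → Fin d) (Fin n → Fin d) ℂ

/-- The rank-one operator `|ψ⟩⟨ψ|`. -/
def ketbra {n d : ℕ} (ψ : (Fin n → Fin d) → ℂ) : Operator n d :=
  Matrix.vecMulVec ψ (star ψ)

/-- A quantum state (density matrix): positive semidefinite of trace one. -/
structure IsState {n d : ℕ} (ρ : Operator n d) : Prop where
  posSemidef : ρ.PosSemidef
  trace_eq_one : ρ.trace = 1

/-! ### The diagonally symmetric subspace -/

/-- The permutation operator `P_π = ∑ᵢ |i_{π⁻¹(1)} … i_{π⁻¹(n)}⟩⟨i₁ … i_n|`. -/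
def permOperator {n : ℕ} (d : ℕ) (π : Equiv.Perm (Fin n)) : Operator n d :=
  Matrix.of fun a b => if a = (fun k => b (π⁻¹ k)) then 1 else 0

/-- The projection `Π = (1 / n!) ∑_π P_π` onto the symmetric subspace of `(ℂ^d)^{⊗n}`. -/
def symProjection (n d : ℕ) : Operator n d :=
  ((n.factorial : ℂ)⁻¹) • ∑ π : Equiv.Perm (Fin n), permOperator d π

/-- The tensor power `U^{⊗n}` of a `d × d` matrix. -/
def tensorPower (n : ℕ) {d : ℕ} (U : Matrix (Fin d) (Fin d) ℂ) : Operator n d :=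
  Matrix.of fun a b => ∏ k, U (a k) (b k)

/-- Membership in the diagonally symmetric subspace: `Π X Π = X`, and `X` commutes with `U^{⊗n}`
for every diagonal unitary `U = diag(e^{iθ₁}, …, e^{iθ_d})`. -/
structure IsDiagonallySymmetric {n d : ℕ} (X : Operator n d) : Prop where
  bosonic : symProjection n d * X * symProjection n d = X
  diagonal_unitary_invariant : ∀ θ : Fin d → ℝ,
    Commute
      (tensorPower n (Matrix.diagonal fun j => Complex.exp (Complex.I * (θ j : ℂ)))) X

/-! ### Dicke states and their mixtures -/

/-- The occupation vector of a multi-index: entry `j` counts the positions with value `j`. -/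
def occupation {n d : ℕ} (i : Fin n → Fin d) : Fin d → ℕ :=
  fun j => (Finset.univ.filter fun k => i k = j).card

/-- The set of occupation vectors `α ∈ ℕ^d` with `α₁ + … + α_d = n`. -/
def occupationVectors (n d : ℕ) : Finset (Fin d → ℕ) :=
  Finset.piAntidiag Finset.univ n

/-- The qudit Dicke state
`|D_α⟩ = (n! / (α₁! ⋯ α_d!))^{-1/2} ∑_{i of occupation α} |i⟩`, for `α` with `|α| = n`. -/
def dickeState (n : ℕ) {d : ℕ} (α : Fin d → ℕ) : (Fin n → Fin d) → ℂ :=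
  fun i => if occupation i = α
    then (((Real.sqrt (Nat.multinomial Finset.univ α : ℝ))⁻¹ : ℝ) : ℂ) else 0

/-- `ρ` is a mixture of Dicke states: `ρ = ∑_α p_α |D_α⟩⟨D_α|` for a probability distribution `p`
on the occupation vectors. -/
def IsMixtureOfDickeStates {n d : ℕ} (ρ : Operator n d) : Prop :=
  ∃ p : (Fin d → ℕ) → ℝ,
    (∀ α ∈ occupationVectors n d, 0 ≤ p α) ∧
    ∑ α ∈ occupationVectors n d, p α = 1 ∧
    ρ = ∑ α ∈ occupationVectors n d, (p α : ℂ) • ketbra (dickeState n α)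

/-! ### Partial transposes and entanglement -/

/-- The partial transpose `X^{Γ_I}` of the tensor factors in `I`. -/
def partialTranspose {n d : ℕ} (I : Finset (Fin n)) (X : Operator n d) : Operator n d :=
  Matrix.of fun a b =>
    X (fun k => if k ∈ I then b k else a k) (fun k => if k ∈ I then a k else b k)

/-- Positive partial transpose across every bipartition `I : [n] ∖ I`. -/
def IsPPT {n d : ℕ} (X : Operator n d) : Prop :=
  ∀ I : Finset (Fin n), (partialTranspose I X).PosSemidef

/-- The product vector `v₁ ⊗ ⋯ ⊗ v_n`. -/
def productVector {n d : ℕ} (v : Fin n → Fin d → ℂ) : (Fin n → Fin d) → ℂ :=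
  fun i => ∏ k, v k (i k)

/-- (Full) separability: membership in the convex cone generated by the `|ψ⟩⟨ψ|` with `ψ` a product
vector; nonnegative weights are absorbed in the vectors. -/
def IsSeparable {n d : ℕ} (X : Operator n d) : Prop :=
  ∃ (K : ℕ) (v : Fin K → Fin n → Fin d → ℂ), X = ∑ q, ketbra (productVector (v q))

/-- A state is entangled when it is not separable. -/
def IsEntangled {n d : ℕ} (X : Operator n d) : Prop :=
  ¬ IsSeparable X

end DickePPT

end

/-! Take an operator whose entry between indices of equal occupation `α` is `w α`, with all other
entries zero. It is diagonally symmetric and a mixture of Dicke states for every nonnegative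
normalized `w`, so only `w` has to be chosen. PPT only compares midpoints: off-diagonal entries of a
partial transpose are values `w γ` facing diagonal entries `w α`, `w β` with `α + β = 2γ`, so
diagonal dominance suffices (`isPPT_weightOperator`). Separability also constrains barycenters of
three points. With three distinct levels `x, y, z`, the occupation `τ` of `xyz⋯z` is the barycenter
of those of `z⋯z`, `xxyz⋯z`, `xyyz⋯z`, and AM-GM on symmetric product vectors gives
`motzkin_le_of_isSeparable`. Put `w = T ^ e / Z`. The triangle has `τ` as its only interior lattice
point, which leaves room for an `e` that is strictly midpoint convex on the lattice but larger at
`τ` than at the three vertices (`exponent_midpoint`, `exponent_motzkin`). -/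

namespace DickePPT

/-! ### Diagonally dominant matrices -/

/-- A symmetric real matrix whose off-diagonal entries are small compared with the geometric means
of the corresponding diagonal entries is positive semidefinite. -/
theorem posSemidef_of_card_sq_mul_sq_le {ι : Type*} [Fintype ι] [DecidableEq ι]
    (N : Matrix ι ι ℝ) (hsymm : ∀ i j, N i j = N j i) (hdiag : ∀ i, 0 ≤ N i i)
    (hoff : ∀ i j, i ≠ j → (Fintype.card ι : ℝ) ^ 2 * N i j ^ 2 ≤ N i i * N j j) :
    N.PosSemidef := by
  refine Matrix.PosSemidef.of_dotProduct_mulVec_nonneg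
    (Matrix.IsHermitian.ext fun i j => by simpa using hsymm j i) fun x => ?_
  rcases isEmpty_or_nonempty ι with hι | hι
  · simp [dotProduct]
  set K : ℝ := (Fintype.card ι : ℝ) with hK
  have hKpos : 0 < K := by
    rw [hK]
    exact_mod_cast Fintype.card_pos
  -- AM-GM for each pair; summed over all pairs, the negative terms cancel the diagonal bonus
  -- exactly.
  have key : ∀ i j, -(N i i * x i ^ 2 + N j j * x j ^ 2) / 2
      + (if i = j then K * (N i i * x i ^ 2) else 0) ≤ K * (x i * (N i j * x j)) := by
    intro i j
    by_cases hij : i = j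
    · subst hij
      have := mul_nonneg (hdiag i) (sq_nonneg (x i))
      simp only [if_true]
      nlinarith
    · rw [if_neg hij]
      have h1 : (2 * (K * (x i * (N i j * x j)))) ^ 2
          ≤ (N i i * x i ^ 2 + N j j * x j ^ 2) ^ 2 := by
        have := mul_le_mul_of_nonneg_right (hoff i j hij) (mul_nonneg (sq_nonneg (x i))
          (sq_nonneg (x j)))
        nlinarith [sq_nonneg (N i i * x i ^ 2 - N j j * x j ^ 2)]
      have h2 := abs_le_of_sq_le_sq' h1 (add_nonneg (mul_nonneg (hdiag i) (sq_nonneg _))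
        (mul_nonneg (hdiag j) (sq_nonneg _)))
      linarith [h2.1]
  have hsum := Finset.sum_le_sum fun i (_ : i ∈ Finset.univ) =>
    Finset.sum_le_sum fun j (_ : j ∈ Finset.univ) => key i j
  have hleft : ∑ i, ∑ j, (-(N i i * x i ^ 2 + N j j * x j ^ 2) / 2
      + (if i = j then K * (N i i * x i ^ 2) else 0)) = 0 := by
    simp only [Finset.sum_add_distrib, ← Finset.sum_div, Finset.sum_neg_distrib,
      Finset.sum_ite_eq, Finset.mem_univ, if_true, Finset.sum_const, Finset.card_univ,
      nsmul_eq_mul, ← Finset.mul_sum, ← hK]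
    ring
  have hright : ∑ i, ∑ j, K * (x i * (N i j * x j)) = K * (star x ⬝ᵥ N.mulVec x) := by
    simp [dotProduct, Matrix.mulVec, Finset.mul_sum]
  rw [hleft, hright] at hsum
  exact nonneg_of_mul_nonneg_right hsum hKpos

-- A real square root exhibits `N` as a Gram matrix, and this factorization survives
-- complexification.
open scoped MatrixOrder in
theorem posSemidef_map_ofReal {ι : Type*} [Fintype ι] {N : Matrix ι ι ℝ} (hN : N.PosSemidef) :
    (N.map (fun r : ℝ => (r : ℂ))).PosSemidef := by
  classical
  obtain ⟨B, hB, -, rfl⟩ := CFC.exists_sqrt_of_isSelfAdjoint_of_quasispectrumRestricts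
    hN.isHermitian (QuasispectrumRestricts.nnreal_of_nonneg hN.nonneg)
  have hB' : B.conjTranspose = B := hB
  rw [← congrArg (· * B) hB']
  have h : (B.conjTranspose * B).map (fun r : ℝ => (r : ℂ))
      = (B.map (fun r : ℝ => (r : ℂ))).conjTranspose * B.map (fun r : ℝ => (r : ℂ)) := by
    ext i j
    simp [Matrix.mul_apply]
  rw [h]
  exact Matrix.posSemidef_conjTranspose_mul_self _

/-! ### Occupation vectors -/

theorem occupation_apply {n d : ℕ} (i : Fin n → Fin d) (j : Fin d) :
    occupation i j = ∑ k, if i k = j then 1 else 0 := by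
  simp [occupation]

theorem sum_occupation {n d : ℕ} (i : Fin n → Fin d) : ∑ j, occupation i j = n := by
  simp only [occupation_apply]
  rw [Finset.sum_comm]
  simp

theorem occupation_mem {n d : ℕ} (i : Fin n → Fin d) :
    occupation i ∈ occupationVectors n d := by
  simp [occupationVectors, sum_occupation]

theorem occupation_comp_perm {n d : ℕ} (i : Fin n → Fin d) (π : Equiv.Perm (Fin n)) :
    occupation (fun k => i (π k)) = occupation i := by
  ext j
  simp only [occupation_apply]
  exact Equiv.sum_comp π fun k => if i k = j then 1 else 0

theorem prod_comp_eq_prod_pow_occupation {n d : ℕ} {R : Type*} [CommMonoid R] (f : Fin d → R)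
    (i : Fin n → Fin d) : ∏ k, f (i k) = ∏ j, f j ^ occupation i j := by
  rw [← Finset.prod_fiberwise' Finset.univ i f]
  simp [occupation]

/-- The number of multi-indices with a given occupation vector is a multinomial coefficient. -/
theorem card_occupation_eq {n d : ℕ} {α : Fin d → ℕ} (hα : α ∈ occupationVectors n d) :
    (Finset.univ.filter fun i : Fin n → Fin d => occupation i = α).card
      = Nat.multinomial Finset.univ α := by
  -- Expand `(∑ X_j) ^ n` in two ways and compare coefficients of the monomial with exponent `α`.
  have h1 := Finset.sum_pow_eq_sum_piAntidiag Finset.univ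
    (fun j : Fin d => (MvPolynomial.X j : MvPolynomial (Fin d) ℕ)) n
  rw [Fintype.sum_pow] at h1
  simp only [prod_comp_eq_prod_pow_occupation] at h1
  have hmon : ∀ β : Fin d → ℕ, (∏ j, (MvPolynomial.X j : MvPolynomial (Fin d) ℕ) ^ β j)
      = MvPolynomial.monomial (Finsupp.equivFunOnFinite.symm β) 1 := by
    intro β
    rw [MvPolynomial.monomial_eq, Finsupp.prod_fintype _ _ (by simp)]
    simp
  have h2 := congrArg (MvPolynomial.coeff (Finsupp.equivFunOnFinite.symm α)) h1
  have hcast : ∀ m : ℕ, (m : MvPolynomial (Fin d) ℕ) = MvPolynomial.C m := fun m => by simp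
  simp only [hmon, MvPolynomial.coeff_sum, hcast, MvPolynomial.coeff_C_mul,
    MvPolynomial.coeff_monomial, Equiv.apply_eq_iff_eq] at h2
  rw [Finset.card_filter, h2]
  unfold occupationVectors at hα
  rw [Finset.sum_eq_single_of_mem α hα fun β _ hβ => by simp [hβ]]
  simp

/-! ### Operators determined by a weight on occupation vectors -/

/-- The operator whose matrix element between `|a⟩` and `|b⟩` is `w α` when both multi-indices have
occupation vector `α`, and zero when the occupation vectors differ. -/
def weightOperator (n : ℕ) {d : ℕ} (w : (Fin d → ℕ) → ℝ) : Operator n d :=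
  Matrix.of fun a b => if occupation a = occupation b then (w (occupation a) : ℂ) else 0

theorem weightOperator_apply {n d : ℕ} (w : (Fin d → ℕ) → ℝ) (a b : Fin n → Fin d) :
    weightOperator n w a b
      = if occupation a = occupation b then (w (occupation a) : ℂ) else 0 := rfl

theorem permOperator_mul_weightOperator {n d : ℕ} (π : Equiv.Perm (Fin n))
    (w : (Fin d → ℕ) → ℝ) : permOperator d π * weightOperator n w = weightOperator n w := by
  ext a b
  have h : ∀ c : Fin n → Fin d, (a = fun k => c (π⁻¹ k)) ↔ c = fun k => a (π k) := by
    intro c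
    constructor
    · rintro rfl
      simp
    · rintro rfl
      simp
  rw [Matrix.mul_apply]
  simp only [permOperator, Matrix.of_apply, h, ite_mul, one_mul, zero_mul, Finset.sum_ite_eq',
    Finset.mem_univ, if_true, weightOperator_apply, occupation_comp_perm]

theorem weightOperator_mul_permOperator {n d : ℕ} (π : Equiv.Perm (Fin n))
    (w : (Fin d → ℕ) → ℝ) : weightOperator n w * permOperator d π = weightOperator n w := by
  ext a b
  rw [Matrix.mul_apply]
  simp only [permOperator, Matrix.of_apply, mul_ite, mul_one, mul_zero, Finset.sum_ite_eq',
    Finset.mem_univ, if_true, weightOperator_apply, occupation_comp_perm]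

theorem symProjection_mul_weightOperator {n d : ℕ} (w : (Fin d → ℕ) → ℝ) :
    symProjection n d * weightOperator n w = weightOperator n w := by
  rw [symProjection, Matrix.smul_mul, Finset.sum_mul]
  simp only [permOperator_mul_weightOperator, Finset.sum_const, Finset.card_univ,
    Fintype.card_perm, Fintype.card_fin]
  rw [← Nat.cast_smul_eq_nsmul ℂ, smul_smul,
    inv_mul_cancel₀ (by exact_mod_cast n.factorial_ne_zero), one_smul]

theorem weightOperator_mul_symProjection {n d : ℕ} (w : (Fin d → ℕ) → ℝ) :
    weightOperator n w * symProjection n d = weightOperator n w := by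
  rw [symProjection, Matrix.mul_smul, Finset.mul_sum]
  simp only [weightOperator_mul_permOperator, Finset.sum_const, Finset.card_univ,
    Fintype.card_perm, Fintype.card_fin]
  rw [← Nat.cast_smul_eq_nsmul ℂ, smul_smul,
    inv_mul_cancel₀ (by exact_mod_cast n.factorial_ne_zero), one_smul]

theorem tensorPower_diagonal {n d : ℕ} (u : Fin d → ℂ) :
    tensorPower n (Matrix.diagonal u)
      = Matrix.diagonal fun a : Fin n → Fin d => ∏ j, u j ^ occupation a j := by
  ext a b
  rw [tensorPower, Matrix.of_apply, Matrix.diagonal_apply]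
  split_ifs with h
  · subst h
    simp [prod_comp_eq_prod_pow_occupation]
  · obtain ⟨k, hk⟩ := Function.ne_iff.mp h
    exact Finset.prod_eq_zero (Finset.mem_univ k) (Matrix.diagonal_apply_ne _ hk)

theorem isDiagonallySymmetric_weightOperator {n d : ℕ} (w : (Fin d → ℕ) → ℝ) :
    IsDiagonallySymmetric (weightOperator n w) where
  bosonic := by rw [symProjection_mul_weightOperator, weightOperator_mul_symProjection]
  diagonal_unitary_invariant θ := by
    rw [tensorPower_diagonal]
    ext a b
    rw [Matrix.diagonal_mul, Matrix.mul_diagonal, weightOperator_apply]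
    split_ifs with h
    · rw [h, mul_comm]
    · simp

theorem trace_weightOperator {n d : ℕ} (w : (Fin d → ℕ) → ℝ) :
    (weightOperator n w).trace = ((∑ a : Fin n → Fin d, w (occupation a) : ℝ) : ℂ) := by
  simp [Matrix.trace, weightOperator_apply]

theorem isMixtureOfDickeStates_weightOperator {n d : ℕ} {w : (Fin d → ℕ) → ℝ}
    (hw : ∀ α, 0 ≤ w α) (hsum : ∑ a : Fin n → Fin d, w (occupation a) = 1) :
    IsMixtureOfDickeStates (weightOperator n w) := by
  -- The multinomial factor cancels the squared normalization of the Dicke state.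
  refine ⟨fun α => (Nat.multinomial Finset.univ α : ℝ) * w α,
    fun α _ => mul_nonneg (Nat.cast_nonneg _) (hw α), ?_, ?_⟩
  · rw [← hsum, ← Finset.sum_fiberwise_of_maps_to fun a _ => occupation_mem a]
    refine Finset.sum_congr rfl fun α hα => ?_
    rw [Finset.sum_congr rfl fun a ha => by rw [(Finset.mem_filter.mp ha).2], Finset.sum_const,
      card_occupation_eq hα, nsmul_eq_mul]
  · ext a b
    rw [Matrix.sum_apply, Finset.sum_eq_single_of_mem _ (occupation_mem a)]
    · have hM : (0 : ℝ) < Nat.multinomial Finset.univ (occupation a) := by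
        exact_mod_cast Nat.multinomial_pos _ _
      by_cases h : occupation a = occupation b
      · have hs : ((√(Nat.multinomial Finset.univ (occupation a) : ℝ))⁻¹ : ℝ)
            * (√(Nat.multinomial Finset.univ (occupation a) : ℝ))⁻¹
            = (Nat.multinomial Finset.univ (occupation a) : ℝ)⁻¹ := by
          rw [← mul_inv, Real.mul_self_sqrt hM.le]
        simp only [weightOperator_apply, Matrix.smul_apply, ketbra, Matrix.vecMulVec_apply,
          dickeState, Pi.star_apply, if_true, if_pos h, if_pos h.symm, smul_eq_mul,
          Complex.star_def, Complex.conj_ofReal]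
        rw [← Complex.ofReal_mul, ← Complex.ofReal_mul, hs]
        congr 1
        field_simp
      · simp [weightOperator_apply, ketbra, Matrix.vecMulVec_apply, dickeState, h, Ne.symm h]
    · intro α _ hα
      simp [ketbra, Matrix.vecMulVec_apply, dickeState, hα.symm]

/-! ### Partial transposes -/

/-- The occupation vectors of the parts of a multi-index inside and outside of `I`. -/
def splitOccupation {n d : ℕ} (I : Finset (Fin n)) (a : Fin n → Fin d) :
    (Fin d → ℕ) × (Fin d → ℕ) :=
  (fun j => ∑ k, if k ∈ I then (if a k = j then 1 else 0) else 0,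
    fun j => ∑ k, if k ∈ I then 0 else (if a k = j then 1 else 0))

theorem occupation_ite {n d : ℕ} (I : Finset (Fin n)) (a b : Fin n → Fin d) :
    occupation (fun k => if k ∈ I then a k else b k)
      = (splitOccupation I a).1 + (splitOccupation I b).2 := by
  ext j
  simp only [occupation_apply, splitOccupation, Pi.add_apply, ← Finset.sum_add_distrib]
  refine Finset.sum_congr rfl fun k _ => ?_
  by_cases hk : k ∈ I <;> simp [hk]

theorem splitOccupation_add {n d : ℕ} (I : Finset (Fin n)) (a : Fin n → Fin d) :
    (splitOccupation I a).1 + (splitOccupation I a).2 = occupation a := by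
  rw [← occupation_ite]
  simp

/-- The weights with rapidly decaying midpoint ratios give operators which are PPT across all
bipartitions. -/
theorem isPPT_weightOperator {n d : ℕ} {w : (Fin d → ℕ) → ℝ} (hw : ∀ α, 0 ≤ w α)
    (hmid : ∀ α β γ : Fin d → ℕ, ∑ j, α j = n → ∑ j, β j = n → α ≠ β → α + β = γ + γ →
      ((d : ℝ) ^ n) ^ 2 * w γ ^ 2 ≤ w α * w β) :
    IsPPT (weightOperator n w) := by
  intro I
  classical
  let F : (Fin n → Fin d) → (Fin d → ℕ) × (Fin d → ℕ) := splitOccupation I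
  -- The partial transpose depends on `a`, `b` only through their split occupations. Passing to this
  -- quotient removes repeated rows, which would defeat diagonal dominance.
  let N : Matrix (Set.range F) (Set.range F) ℝ := Matrix.of fun s t =>
    if t.1.1 + s.1.2 = s.1.1 + t.1.2 then w (t.1.1 + s.1.2) else 0
  have hN : N.PosSemidef := by
    refine posSemidef_of_card_sq_mul_sq_le N ?_ ?_ ?_
    · intro s t
      by_cases h : t.1.1 + s.1.2 = s.1.1 + t.1.2
      · simp [N, h]
      · simp [N, h, Ne.symm h]
    · intro s
      simp [N, hw]
    · rintro ⟨s, a, rfl⟩ ⟨t, b, rfl⟩ hst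
      have hcard : (Fintype.card (Set.range F) : ℝ) ≤ (d : ℝ) ^ n := by
        have := Fintype.card_le_of_surjective (Set.rangeFactorization F)
          Set.rangeFactorization_surjective
        rw [Fintype.card_fun, Fintype.card_fin, Fintype.card_fin] at this
        exact_mod_cast this
      simp only [N, Matrix.of_apply, if_true]
      by_cases h : (F b).1 + (F a).2 = (F a).1 + (F b).2
      · rw [if_pos h]
        refine le_trans ?_ (hmid ((F a).1 + (F a).2) ((F b).1 + (F b).2) ((F b).1 + (F a).2)
          ?_ ?_ ?_ ?_)
        · gcongr
        · rw [splitOccupation_add, sum_occupation]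
        · rw [splitOccupation_add, sum_occupation]
        -- Equal totals together with equal crossed sums force equal split occupations.
        · intro heq
          refine hst (Subtype.ext (Prod.ext (funext fun j => ?_) (funext fun j => ?_)))
          · have h1 := congrFun heq j
            have h2 := congrFun h j
            simp only [Pi.add_apply] at h1 h2
            change (F a).1 j = (F b).1 j
            omega
          · have h1 := congrFun heq j
            have h2 := congrFun h j
            simp only [Pi.add_apply] at h1 h2
            change (F a).2 j = (F b).2 j
            omega
        · nth_rewrite 2 [h]
          abel
      · rw [if_neg h]
        simpa using mul_nonneg (hw _) (hw _)
  have hM : partialTranspose I (weightOperator n w)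
      = (N.map (fun r : ℝ => (r : ℂ))).submatrix (Set.rangeFactorization F)
        (Set.rangeFactorization F) := by
    ext a b
    simp only [partialTranspose, Matrix.of_apply, weightOperator_apply, occupation_ite,
      Matrix.submatrix_apply, Matrix.map_apply, N, F]
    change _ = ((if (splitOccupation I b).1 + (splitOccupation I a).2
      = (splitOccupation I a).1 + (splitOccupation I b).2 then
        w ((splitOccupation I b).1 + (splitOccupation I a).2) else 0 : ℝ) : ℂ)
    split_ifs <;> simp
  rw [hM]
  exact (posSemidef_map_ofReal hN).submatrix _

theorem partialTranspose_empty {n d : ℕ} (X : Operator n d) : partialTranspose ∅ X = X := by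
  ext a b
  simp [partialTranspose]

/-! ### A Motzkin-type inequality for separable operators -/

/-- The multi-index `(p, q, r, z, …, z)`. -/
def tripleIndex {m d : ℕ} (z p q r : Fin d) : Fin (m + 3) → Fin d :=
  Fin.cons p (Fin.cons q (Fin.cons r fun _ => z))

theorem occupation_tripleIndex {m d : ℕ} (z p q r j : Fin d) :
    occupation (tripleIndex (m := m) z p q r) j
      = (if p = j then 1 else 0) + (if q = j then 1 else 0) + (if r = j then 1 else 0)
        + (if z = j then m else 0) := by
  rw [occupation_apply]
  simp only [tripleIndex, Fin.sum_univ_succ, Fin.cons_zero, Fin.cons_succ, Finset.sum_const,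
    Finset.card_univ, Fintype.card_fin, smul_eq_mul, mul_ite, mul_one, mul_zero, add_assoc]

theorem productVector_tripleIndex {m d : ℕ} (v : Fin (m + 3) → Fin d → ℂ) (z p q r : Fin d) :
    productVector v (tripleIndex z p q r)
      = v 0 p * v 1 q * v 2 r * ∏ k : Fin m, v k.succ.succ.succ z := by
  simp only [productVector, tripleIndex, Fin.prod_univ_succ, Fin.cons_zero, Fin.cons_succ]
  simp only [mul_assoc]
  rfl

theorem sum_ketbra_apply {n d K : ℕ} (ψ : Fin K → (Fin n → Fin d) → ℂ) (a b : Fin n → Fin d) :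
    (∑ q, ketbra (ψ q)) a b = ∑ q, ψ q a * star (ψ q b) := by
  simp [Matrix.sum_apply, ketbra, Matrix.vecMulVec_apply]

/-- Vectors in a decomposition of a weight operator are symmetric. -/
theorem apply_eq_of_weightOperator_eq_sum {n d K : ℕ} {w : (Fin d → ℕ) → ℝ}
    {ψ : Fin K → (Fin n → Fin d) → ℂ} (h : weightOperator n w = ∑ q, ketbra (ψ q))
    {a b : Fin n → Fin d} (hab : occupation a = occupation b) (q : Fin K) : ψ q a = ψ q b := by
  have hent : ∀ c c' : Fin n → Fin d, occupation c = occupation a → occupation c' = occupation a →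
      ∑ q, ψ q c * star (ψ q c') = (w (occupation a) : ℂ) := by
    intro c c' hc hc'
    rw [← sum_ketbra_apply, ← h, weightOperator_apply, if_pos (hc.trans hc'.symm), hc]
  -- The four entries obtained by expanding the squares coincide, so they cancel.
  have hzero : ∑ q, ((Complex.normSq (ψ q a - ψ q b) : ℝ) : ℂ) = 0 := by
    have hexp : ∀ q, ((Complex.normSq (ψ q a - ψ q b) : ℝ) : ℂ)
        = ψ q a * star (ψ q a) - ψ q a * star (ψ q b) - ψ q b * star (ψ q a)
          + ψ q b * star (ψ q b) := by
      intro q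
      rw [← Complex.mul_conj, map_sub, Complex.star_def]
      ring
    simp only [hexp, Finset.sum_add_distrib, Finset.sum_sub_distrib]
    rw [hent a a rfl rfl, hent a b rfl hab.symm, hent b a hab.symm rfl,
      hent b b hab.symm hab.symm]
    ring
  have hzero' : ∑ q, Complex.normSq (ψ q a - ψ q b) = 0 := by exact_mod_cast hzero
  have := (Finset.sum_eq_zero_iff_of_nonneg fun q _ => Complex.normSq_nonneg _).mp hzero' q
    (Finset.mem_univ q)
  exact sub_eq_zero.mp (Complex.normSq_eq_zero.mp this)

theorem three_mul_le_of_pow_three_eq {s a b c : ℝ} (ha : 0 ≤ a) (hb : 0 ≤ b)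
    (hc : 0 ≤ c) (h : s ^ 3 = a * b * c) : 3 * s ≤ a + b + c := by
  have hamgm : 27 * (a * b * c) ≤ (a + b + c) ^ 3 := by
    nlinarith [mul_nonneg ha (sq_nonneg (b - c)), mul_nonneg hb (sq_nonneg (a - c)),
      mul_nonneg hc (sq_nonneg (a - b)), mul_nonneg (add_nonneg (add_nonneg ha hb) hc)
        (add_nonneg (add_nonneg (sq_nonneg (a - b)) (sq_nonneg (b - c))) (sq_nonneg (a - c)))]
  refine le_of_pow_le_pow_left₀ (n := 3) (by norm_num) (by positivity) ?_
  rw [mul_pow, h]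
  linarith

/-- The inequality coming from nonnegativity of the Motzkin form
`x² y z^m + x y² z^m + z^(m+3) - 3 x y z^(m+1)` on the nonnegative orthant. -/
theorem motzkin_le_of_isSeparable {m d : ℕ} {w : (Fin d → ℕ) → ℝ} (x y z : Fin d)
    (h : IsSeparable (weightOperator (m + 3) w)) :
    3 * w (occupation (tripleIndex (m := m) z x y z))
      ≤ w (occupation (tripleIndex (m := m) z z z z))
        + w (occupation (tripleIndex (m := m) z x x y))
        + w (occupation (tripleIndex (m := m) z y y x)) := by
  obtain ⟨K, v, hv⟩ := h
  have hdiag : ∀ a : Fin (m + 3) → Fin d,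
      w (occupation a) = ∑ q, Complex.normSq (productVector (v q) a) := by
    intro a
    have h1 : weightOperator (m + 3) w a a = (w (occupation a) : ℂ) := by
      simp [weightOperator_apply]
    rw [hv, sum_ketbra_apply] at h1
    simp only [Complex.star_def, Complex.mul_conj] at h1
    exact_mod_cast h1.symm
  simp only [hdiag, Finset.mul_sum, ← Finset.sum_add_distrib]
  refine Finset.sum_le_sum fun q _ => ?_
  refine three_mul_le_of_pow_three_eq (Complex.normSq_nonneg _)
    (Complex.normSq_nonneg _) (Complex.normSq_nonneg _) ?_
  -- By symmetry the cube of the `xyz` amplitude is the product over the cyclic shifts `xyz`, `zxy`,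
  -- `yzx`. Each of the first three slots then carries `x, y, z` once, as it does for `zzz`, `xxy`,
  -- `yyx`.
  have h1 := apply_eq_of_weightOperator_eq_sum hv
    (a := tripleIndex z x y z) (b := tripleIndex z z x y)
    (by ext j; simp only [occupation_tripleIndex]; ring) q
  have h2 := apply_eq_of_weightOperator_eq_sum hv
    (a := tripleIndex z x y z) (b := tripleIndex z y z x)
    (by ext j; simp only [occupation_tripleIndex]; ring) q
  have h3 : productVector (v q) (tripleIndex z x y z) ^ 3
      = productVector (v q) (tripleIndex z z z z) * productVector (v q) (tripleIndex z x x y)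
        * productVector (v q) (tripleIndex z y y x) := by
    rw [pow_succ, pow_two]
    nth_rewrite 2 [h1]
    nth_rewrite 2 [h2]
    simp only [productVector_tripleIndex]
    ring
  rw [← map_pow, h3, map_mul, map_mul]

/-! ### A lattice-midpoint-convex exponent which is not convex -/

/-- A convex piecewise linear function on the plane. -/
def planeGauge (u v : ℤ) : ℤ := max (v - 2 * u) (max (u - 2 * v) (u + v))

/-- The exponent: a strictly convex function plus a bump at the occupation vector of
`(x, y, z, z, …, z)`. -/
def exponent {d : ℕ} (x y : Fin d) (τ α : Fin d → ℕ) : ℤ :=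
  20 * planeGauge (α x - 1) (α y - 1) + ∑ j, ((α j : ℤ) - τ j) ^ 2 + if α = τ then 28 else 0

/-- The quadratic term alone supplies the gap 2. The gauge is convex and pays for the bump when the
midpoint is `τ`. -/
theorem exponent_midpoint {n d : ℕ} {x y z : Fin d} {τ α β γ : Fin d → ℕ} (hτx : τ x = 1)
    (hτy : τ y = 1) (hτ : ∀ j, j ≠ x → j ≠ y → j ≠ z → τ j = 0) (hα : ∑ j, α j = n)
    (hβ : ∑ j, β j = n) (hne : α ≠ β) (hmid : α + β = γ + γ) :
    2 * exponent x y τ γ + 2 ≤ exponent x y τ α + exponent x y τ β := by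
  have hm : ∀ j, α j + β j = γ j + γ j := fun j => congrFun hmid j
  have hquad : 2 * ∑ j, ((γ j : ℤ) - τ j) ^ 2 + 2
      ≤ ∑ j, ((α j : ℤ) - τ j) ^ 2 + ∑ j, ((β j : ℤ) - τ j) ^ 2 := by
    have hsq : ∑ j, ((α j : ℤ) - τ j) ^ 2 + ∑ j, ((β j : ℤ) - τ j) ^ 2
        = 2 * ∑ j, ((γ j : ℤ) - τ j) ^ 2 + 2 * ∑ j, ((α j : ℤ) - γ j) ^ 2 := by
      rw [Finset.mul_sum, Finset.mul_sum, ← Finset.sum_add_distrib, ← Finset.sum_add_distrib]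
      refine Finset.sum_congr rfl fun j _ => ?_
      have : (β j : ℤ) = γ j + γ j - α j := by have := hm j; omega
      rw [this]
      ring
    obtain ⟨j, hj⟩ := Function.ne_iff.mp hne
    have hj' : (α j : ℤ) - γ j ≠ 0 := by have := hm j; omega
    have h1 : 1 ≤ ((α j : ℤ) - γ j) ^ 2 := by
      have := sq_pos_of_ne_zero hj'
      omega
    have h2 := Finset.single_le_sum (f := fun j => ((α j : ℤ) - γ j) ^ 2)
      (fun j _ => sq_nonneg _) (Finset.mem_univ j)
    omega
  have hx := hm x
  have hy := hm y
  have hbump : ∀ δ : Fin d → ℕ, (0 : ℤ) ≤ if δ = τ then 28 else 0 := fun δ => by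
    split_ifs <;> norm_num
  have hbα := hbump α
  have hbβ := hbump β
  by_cases hγ : γ = τ
  -- Otherwise `α` and `β` agree with `τ` away from `z`, and the fixed total settles `z`.
  · have hxy : ¬ (α x = 1 ∧ α y = 1) := by
      rintro ⟨h1, h2⟩
      apply hne
      have hoff : ∀ j, j ≠ z → α j = β j := by
        intro j hjz
        have hj := hm j
        rw [hγ] at hj hx hy
        by_cases hjx : j = x
        · subst hjx; omega
        by_cases hjy : j = y
        · subst hjy; omega
        rw [hτ j hjx hjy hjz] at hj
        omega
      have hsum : α z + ∑ j ∈ Finset.univ.erase z, α j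
          = β z + ∑ j ∈ Finset.univ.erase z, β j := by
        rw [Finset.add_sum_erase _ _ (Finset.mem_univ z),
          Finset.add_sum_erase _ _ (Finset.mem_univ z), hα, hβ]
      rw [Finset.sum_congr rfl fun j hj => hoff j (Finset.ne_of_mem_erase hj)] at hsum
      ext j
      by_cases hjz : j = z
      · subst hjz
        exact Nat.add_right_cancel hsum
      · exact hoff j hjz
    -- At opposite points the gauge values add up to the spread of the three linear forms. Their
    -- differences are multiples of 3, all zero only at the origin. Hence a gain of `20 * 3 = 60`,
    -- against a cost of `2 * 28 = 56`.
    have hg : 2 * planeGauge (γ x - 1) (γ y - 1) + 3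
        ≤ planeGauge (α x - 1) (α y - 1) + planeGauge (β x - 1) (β y - 1) := by
      rw [hγ, hτx] at hx
      rw [hγ, hτy] at hy
      rw [hγ, hτx, hτy]
      unfold planeGauge
      omega
    unfold exponent
    rw [if_pos hγ]
    omega
  · have hg : 2 * planeGauge (γ x - 1) (γ y - 1)
        ≤ planeGauge (α x - 1) (α y - 1) + planeGauge (β x - 1) (β y - 1) := by
      unfold planeGauge
      omega
    unfold exponent
    rw [if_neg hγ]
    omega

/-- The gauge is 1 at all three vertices, contributing 20; the squared distances to `τ` are 6, 2, 2.
At `τ` only the bump remains. -/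
theorem exponent_motzkin {m d : ℕ} {x y z : Fin d} (hxy : x ≠ y) (hxz : x ≠ z) (hyz : y ≠ z) :
    let e := exponent x y (occupation (tripleIndex (m := m) z x y z))
    e (occupation (tripleIndex (m := m) z x y z)) = 28 ∧
    e (occupation (tripleIndex (m := m) z z z z)) = 26 ∧
    e (occupation (tripleIndex (m := m) z x x y)) = 22 ∧
    e (occupation (tripleIndex (m := m) z y y x)) = 22 := by
  have hne : ∀ p q r : Fin d, occupation (tripleIndex (m := m) z p q r) z ≠ m + 1 →
      occupation (tripleIndex (m := m) z p q r) ≠ occupation (tripleIndex (m := m) z x y z) := by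
    intro p q r h heq
    rw [heq] at h
    simp [occupation_tripleIndex, hxz, hyz] at h
    omega
  refine ⟨?_, ?_, ?_, ?_⟩
  · simp [exponent, planeGauge, occupation_tripleIndex, hxy, hxy.symm, hxz.symm, hyz.symm]
  · rw [exponent, if_neg (hne _ _ _ (by simp [occupation_tripleIndex]; omega))]
    have hs : ∀ j, ((occupation (tripleIndex (m := m) z z z z) j : ℤ)
        - occupation (tripleIndex (m := m) z x y z) j) ^ 2
        = (if z = j then 4 else 0) + (if x = j then 1 else 0) + (if y = j then 1 else 0) := by
      intro j
      rw [occupation_tripleIndex, occupation_tripleIndex]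
      split_ifs <;> first | (exfalso; simp_all; done) | (push_cast <;> ring)
    simp only [hs]
    simp [ Finset.sum_add_distrib, planeGauge, occupation_tripleIndex, hxz.symm, hyz.symm]
  · rw [exponent, if_neg (hne _ _ _ (by simp [occupation_tripleIndex, hxz, hyz]))]
    have hs : ∀ j, ((occupation (tripleIndex (m := m) z x x y) j : ℤ)
        - occupation (tripleIndex (m := m) z x y z) j) ^ 2
        = (if z = j then 1 else 0) + (if x = j then 1 else 0) := by
      intro j
      rw [occupation_tripleIndex, occupation_tripleIndex]
      split_ifs <;> first | (exfalso; simp_all; done) | (push_cast <;> ring)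
    simp only [hs]
    simp [ Finset.sum_add_distrib, planeGauge, occupation_tripleIndex, hxy, hxy.symm,
      hxz.symm, hyz.symm]
  · rw [exponent, if_neg (hne _ _ _ (by simp [occupation_tripleIndex, hxz, hyz]))]
    have hs : ∀ j, ((occupation (tripleIndex (m := m) z y y x) j : ℤ)
        - occupation (tripleIndex (m := m) z x y z) j) ^ 2
        = (if z = j then 1 else 0) + (if y = j then 1 else 0) := by
      intro j
      rw [occupation_tripleIndex, occupation_tripleIndex]
      split_ifs <;> first | (exfalso; simp_all; done) | (push_cast <;> ring)
    simp only [hs]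
    simp [ Finset.sum_add_distrib, planeGauge, occupation_tripleIndex, hxy, hxy.symm,
      hxz.symm, hyz.symm]

/-! ### The entangled PPT mixtures of Dicke states -/

theorem exists_entangled_isPPT_mixture {d n : ℕ} (hd : 3 ≤ d) (hn : 3 ≤ n) :
    ∃ ρ : Operator n d, IsState ρ ∧ IsDiagonallySymmetric ρ ∧ IsMixtureOfDickeStates ρ ∧
      IsPPT ρ ∧ IsEntangled ρ := by
  obtain ⟨m, rfl⟩ := Nat.exists_eq_add_of_le' hn
  let x : Fin d := ⟨0, by omega⟩
  let y : Fin d := ⟨1, by omega⟩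
  let z : Fin d := ⟨2, by omega⟩
  have hxy : x ≠ y := by simp [x, y]
  have hxz : x ≠ z := by simp [x, z]
  have hyz : y ≠ z := by simp [y, z]
  set τ : Fin d → ℕ := occupation (tripleIndex (m := m) z x y z) with hτ
  -- With this base, the exponent gap 2 yields exactly the factor `(d ^ n) ^ 2` demanded by diagonal
  -- dominance.
  set T : ℝ := (d : ℝ) ^ (m + 3) with hT
  have hT1 : 1 < T := one_lt_pow₀ (by exact_mod_cast (by omega : 1 < d)) (by omega)
  have hT0 : 0 < T := by linarith
  set W : (Fin d → ℕ) → ℝ := fun α => T ^ exponent x y τ α with hW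
  have hWpos : ∀ α, 0 < W α := fun α => zpow_pos hT0 _
  set Z : ℝ := ∑ a : Fin (m + 3) → Fin d, W (occupation a) with hZ
  have hZpos : 0 < Z := Finset.sum_pos (fun a _ => hWpos _) ⟨fun _ => x, Finset.mem_univ _⟩
  have hw : ∀ α, 0 ≤ W α / Z := fun α => (div_pos (hWpos α) hZpos).le
  have hsum : ∑ a : Fin (m + 3) → Fin d, W (occupation a) / Z = 1 := by
    rw [← Finset.sum_div, div_self hZpos.ne']
  have hppt : IsPPT (weightOperator (m + 3) fun α => W α / Z) := by
    refine isPPT_weightOperator hw fun α β γ hα hβ hne hmid => ?_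
    have hexp := exponent_midpoint (x := x) (y := y) (z := z) (τ := τ)
      (by simp [hτ, occupation_tripleIndex, hxy.symm, hxz.symm])
      (by simp [hτ, occupation_tripleIndex, hxy, hyz.symm])
      (fun j h1 h2 h3 => by simp [hτ, occupation_tripleIndex, h1.symm, h2.symm, h3.symm])
      hα hβ hne hmid
    have hle : T ^ 2 * W γ ^ 2 ≤ W α * W β := by
      simp only [hW]
      rw [← zpow_natCast, ← zpow_natCast, ← zpow_mul, ← zpow_add₀ hT0.ne', ← zpow_add₀ hT0.ne']
      refine zpow_le_zpow_right₀ hT1.le ?_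
      push_cast
      linarith
    rw [← hT, div_pow, div_mul_div_comm, ← mul_div_assoc, ← pow_two]
    gcongr
  refine ⟨weightOperator (m + 3) fun α => W α / Z, ⟨?_, ?_⟩,
    isDiagonallySymmetric_weightOperator _, isMixtureOfDickeStates_weightOperator hw hsum,
    hppt, ?_⟩
  -- Positivity is the PPT condition for the empty bipartition.
  · simpa [partialTranspose_empty] using hppt ∅
  · rw [trace_weightOperator, hsum, Complex.ofReal_one]
  · intro hsep
    have h := motzkin_le_of_isSeparable x y z hsep
    obtain ⟨h1, h2, h3, h4⟩ := exponent_motzkin (m := m) hxy hxz hyz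
    simp only [hW, hτ] at h
    rw [h1, h2, h3, h4, ← add_div, ← add_div, ← mul_div_assoc,
      div_le_div_iff_of_pos_right hZpos] at h
    have h5 : T ^ (26 : ℤ) < T ^ (28 : ℤ) := zpow_lt_zpow_right₀ hT1 (by norm_num)
    have h6 : T ^ (22 : ℤ) < T ^ (28 : ℤ) := zpow_lt_zpow_right₀ hT1 (by norm_num)
    linarith

end DickePPT

theorem mainTheorem3 :
    (∀ d n : ℕ, 3 ≤ d → 3 ≤ n →
      ∃ ρ : DickePPT.Operator n d,
        DickePPT.IsState ρ ∧
        DickePPT.IsDiagonallySymmetric ρ ∧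
        DickePPT.IsMixtureOfDickeStates ρ ∧
        DickePPT.IsPPT ρ ∧
        DickePPT.IsEntangled ρ) ∧
    (∀ d : ℕ, d = 3 ∨ d = 4 →
      ¬ ∀ (n : ℕ) (ρ : DickePPT.Operator n d),
          DickePPT.IsMixtureOfDickeStates ρ → DickePPT.IsPPT ρ → DickePPT.IsSeparable ρ) := by
  refine ⟨fun d n hd hn => DickePPT.exists_entangled_isPPT_mixture hd hn, fun d hd h => ?_⟩
  obtain ⟨ρ, -, -, hmix, hppt, hent⟩ :=
    DickePPT.exists_entangled_isPPT_mixture (d := d) (n := 3) (by omega) le_rfl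
  exact hent (h 3 ρ hmix hppt)
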